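/- Let $n\in\{0,1,2,\dots\}$, $x_\omega>0$ and $\mu,\nu,X\in\mathbb R$ with $\nu\neq0$. For $a\ge 0$ put $b=\tfrac12\sqrt{1+4a}$ and let $$\Psi_n(a;x)=\frac1{\sqrt{x_\omega}}\Big[\frac{2\,n!}{\Gamma(n+b+1)}\Big]^{1/2}\Big(\frac{x}{x_\omega}\Big)^{b+\frac12}e^{-\frac{x^2}{2x_\omega^2}}L_n^{(b)}\Big(\frac{x^2}{x_\omega^2}\Big)\quad(x>0),\qquad \Psi_n(a;x)=0\quad(x\le 0)$$ be the wave functions of the pseudoharmonic oscillator on the half-line, where $L_n^{(b)}$ is the associated Laguerre polynomial. Let $$\mathcal W_n(X|a,\mu,\nu)=\frac1{2\pi|\nu|}\Big|\int_{-\infty}^{\infty}\Psi_n(a;y)\,e^{\frac{i\mu}{2\nu}y^2-\frac{iX}{\nu}y}\,dy\Big|^2$$ be the symplectic tomogram of $\Psi_n(a;\cdot)$. Let $D_v(z)$ be the (standard, Whittaker) parabolic cylinder function $$D_v(z)=2^{v/2}e^{-z^2/4}\Big[\frac{\sqrt\pi}{\Gamma(\frac{1-v}2)}\,{}_1F_1\big(-\tfrac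 v2;\tfrac12;\tfrac{z^2}2\big)-\frac{\sqrt{2\pi}\,z}{\Gamma(-\frac v2)}\,{}_1F_1\big(\tfrac{1-v}2;\tfrac32;\tfrac{z^2}2\big)\Big],$$ let $(c)_k=c(c+1)\cdots(c+k-1)$, $(c)_0=1$, and with $\sigma=\operatorname{sgn}\nu$ let $$z=\frac{i\,\sigma X x_\omega\sqrt{|\nu|+i\sigma\mu x_\omega^2}}{\sqrt{|\nu|}\,\sqrt{\nu^2+\mu^2x_\omega^4}},\qquad \bar z=\frac{-i\,\sigma X x_\omega\sqrt{|\nu|-i\sigma\mu x_\omega^2}}{\sqrt{|\nu|}\,\sqrt{\nu^2+\mu^2x_\omega^4}}$$ (so $z=iXx_\omega\sqrt{\nu+i\mu x_\omega^2}\big/\big(\sqrt\nu\sqrt{\nu^2+\mu^2x_\omega^4}\big)$ when $\nu>0$). Roots and powers of complex numbers are principal. Then: 1. For $a=0$ and $x\ge 0$, $$\Psi_n(0;x)=\frac{(-1)^n}{\sqrt{x_\omega}}\,\frac{1}{2^{2n+\frac12}}\Big[\frac{1}{n!\,\Gamma(n+\frac32)}\Big]^{1/2}e^{-\frac{x^2}{2x_\omega^2}}H_{2n+1}\Big(\frac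 x{x_\omega}\Big),$$ with $H_m$ the (physicists') Hermite polynomial. For every $a\ge0$ the integral defining $\mathcal W_n(X|a,\mu,\nu)$ converges absolutely. 2. For $a=0$ the tomogram is the finite double sum $$\mathcal W_n(X|0,\mu,\nu)=\frac1\pi\,\frac{((2n+1)!)^2}{n!\,\Gamma(n+\frac32)}\,\frac{|\nu|^{2n+1}x_\omega}{(\nu^2+\mu^2x_\omega^4)^{n+1}}\,e^{-\frac{X^2x_\omega^2}{2(\nu^2+\mu^2x_\omega^4)}}\sum_{m_1,m_2=0}^{n}\frac{(-1)^{m_1+m_2}}{m_1!\,m_2!}\Big(\frac1{4\nu}\Big)^{m_1+m_2}(\nu-i\mu x_\omega^2)^{m_1}(\nu+i\mu x_\omega^2)^{m_2}\,D_{-(2n-2m_1+2)}(z)\,D_{-(2n-2m_2+2)}(\bar z).$$ 3. For every $a\ge0$, $$\mathcal W_n(X|a,\mu,\nu)=\frac{x_\omega}{2\pi|\nu|}\,\frac{2\,n!}{\Gamma(n+b+1)}\,e^{-\frac{X^2x_\omega^2}{2(\nu^2+\mu^2x_\omega^4)}}\Big(\frac{(b+1)_n}{n!}\Big)^2\left|\sum_{k=0}^{\infty}\frac{(-n)_k}{(b+1)_k\,k!}\,\Gamma\big(2k+b+\tfrac32\big)\Big(\frac{\nu-i\mu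 x_\omega^2}{\nu}\Big)^{-(k+\frac b2+\frac34)}D_{-(2k+b+\frac32)}(z)\right|^2,$$ where the series converges (its terms vanish for $k>n$). -/

import Mathlib

open MeasureTheory

noncomputable section

/-- Confluent hypergeometric function of the first kind `₁F₁(a; c; z) = ∑ (a)_k / (c)_k z^k / k!`
(used below only with `c = 1/2` and `c = 3/2`). -/
def kummerM (a c z : ℂ) : ℂ :=
  ∑' k : ℕ, (ascPochhammer ℂ k).eval a / ((ascPochhammer ℂ k).eval c * (k.factorial : ℂ)) * z ^ k

/-- Whittaker's parabolic cylinder function `D_v(z)`. At the poles of the Gamma functions the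
factors `1 / Γ` take the value `0`, in agreement with the convention `Complex.Gamma (-n) = 0`. -/
def parabolicCylinderD (v z : ℂ) : ℂ :=
  (2 : ℂ) ^ (v / 2) * Complex.exp (-z ^ 2 / 4) *
    ((Real.sqrt Real.pi : ℂ) / Complex.Gamma ((1 - v) / 2) * kummerM (-v / 2) (1 / 2) (z ^ 2 / 2)
      - (Real.sqrt (2 * Real.pi) : ℂ) * z / Complex.Gamma (-v / 2)
          * kummerM ((1 - v) / 2) (3 / 2) (z ^ 2 / 2))

/-- Associated Laguerre polynomial `L_n^{(α)}(x)` for `α > -1`: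
`∑_{i ≤ n} (-1)^i binom(n + α, n - i) x^i / i!`. -/
def laguerreL (n : ℕ) (α x : ℝ) : ℝ :=
  ∑ i ∈ Finset.range (n + 1),
    (-1) ^ i * (Real.Gamma (n + α + 1) / ((n - i).factorial * Real.Gamma (α + i + 1)))
      * (x ^ i / i.factorial)

/-- Physicists' Hermite polynomial `H_m(x) = 2^{m/2} He_m(√2 x)`, where `He_m` is Mathlib's
(probabilists') Hermite polynomial. -/
def physHermite (m : ℕ) (x : ℝ) : ℝ :=
  Real.sqrt 2 ^ m * Polynomial.aeval (Real.sqrt 2 * x) (Polynomial.hermite m)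

/-- The parameter `b = (1/2) √(1 + 4a)`. -/
def phoB (a : ℝ) : ℝ := Real.sqrt (1 + 4 * a) / 2

/-- Wave function `Ψ_n(a; x)` of the pseudoharmonic oscillator with length scale `xω`. It lives on
the half-line `x > 0` and is extended by zero to the real line. -/
def phoWave (a : ℝ) (n : ℕ) (xω x : ℝ) : ℝ :=
  if 0 < x then
    1 / Real.sqrt xω * Real.sqrt (2 * n.factorial / Real.Gamma (n + phoB a + 1))
      * (x / xω) ^ (phoB a + 1 / 2) * Real.exp (-(1 / 2) * (x ^ 2 / xω ^ 2))
      * laguerreL n (phoB a) (x ^ 2 / xω ^ 2)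
  else 0

/-- The integrand in the symplectic tomogram of a pure state `Ψ`. -/
def tomogramIntegrand (Ψ : ℝ → ℂ) (μ ν X y : ℝ) : ℂ :=
  Ψ y * Complex.exp (Complex.I * μ / (2 * ν) * y ^ 2 - Complex.I * X / ν * y)

/-- Symplectic tomogram `W(X | μ, ν)` (with `ħ = 1` and `ν ≠ 0`) of the pure state `Ψ`. -/
def tomogram (Ψ : ℝ → ℂ) (μ ν X : ℝ) : ℝ :=
  1 / (2 * Real.pi * |ν|) * ‖∫ y : ℝ, tomogramIntegrand Ψ μ ν X y‖ ^ 2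

/-- Tomogram `W_n(X | a, μ, ν)` of the pseudoharmonic oscillator. -/
def phoTomogram (a : ℝ) (n : ℕ) (xω μ ν X : ℝ) : ℝ :=
  tomogram (fun y => (phoWave a n xω y : ℂ)) μ ν X

/-- With `σ = sgn ν`, the argument
`i σ X xω √(|ν| + i σ μ xω²) / (√|ν| √(ν² + μ² xω⁴))` (principal square roots) of the parabolic
cylinder functions. Its complex conjugate is obtained by replacing `(μ, X)` by `(-μ, -X)`. -/
def phoArg (xω μ ν X : ℝ) : ℂ :=
  Complex.I * ν.sign * X * xω * ((|ν| : ℝ) + Complex.I * ν.sign * μ * xω ^ 2) ^ (1 / 2 : ℂ)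
    / (Real.sqrt |ν| * Real.sqrt (ν ^ 2 + μ ^ 2 * xω ^ 4))

/-- The `k`-th term of the series for the tomogram with general `a`. -/
def phoTerm (a : ℝ) (n : ℕ) (xω μ ν X : ℝ) (k : ℕ) : ℂ :=
  (ascPochhammer ℂ k).eval (-(n : ℂ)) / ((ascPochhammer ℂ k).eval ((phoB a : ℂ) + 1) * k.factorial)
    * Complex.Gamma (2 * k + phoB a + 3 / 2)
    * (((ν : ℂ) - Complex.I * μ * xω ^ 2) / ν) ^ (-((k : ℂ) + phoB a / 2 + 3 / 4))
    * parabolicCylinderD (-(2 * k + phoB a + 3 / 2)) (phoArg xω μ ν X)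

end

/-! The Laguerre polynomial is a terminating Kummer series, so for `x > 0` the state is a finite
combination of `x ^ (s - 1) * exp (-x ^ 2 / (2 * xω ^ 2))` with `s = 2 * k + b + 3 / 2`. The
tomogram amplitude is therefore a finite sum of integrals of `x ^ (s - 1) * exp (-β * x ^ 2 - γ *
x)` over the half-line, with `β = phoBeta xω μ ν` and `γ = I * X / ν`.

Each integral is a parabolic cylinder function (`integral_rpow_mul_cexp_eq_parabolicCylinderD`):
expand `exp (-γ * x)`, integrate termwise, split the series by parity into two Kummer functions, and
match coefficients with the duplication formula for `Γ`.

Since `Re β > 0`, principal powers of `2 * β` cause no branch problems: the argument becomes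
`phoArg` (`phoArg_eq`), and the prefactor has the stated Gaussian as squared modulus
(`norm_cexp_phoBeta_sq`). This gives the formula for every `a`.

For `a = 0` one has `b = 1 / 2` and `s = 2 * k + 2`. Powers become integral and `Γ` becomes a
factorial, so after `k = n - m` the terms simplify (`phoTerm_zero_eq`). Writing the squared modulus
as a product with the conjugate gives the double sum. -/

/-! ### Mellin transforms of complex Gaussians -/

/-- A power times a Gaussian with a linear exponential factor is integrable on the half-line. -/
theorem integrableOn_rpow_mul_exp_neg_mul_sq_add {b s : ℝ} (hb : 0 < b) (hs : -1 < s) (c : ℝ) :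
    IntegrableOn (fun x : ℝ => x ^ s * Real.exp (-b * x ^ 2 + c * x)) (Set.Ioi 0) := by
  -- Half of the Gaussian absorbs the linear term: `c * x ≤ c ^ 2 / (2 * b) + b / 2 * x ^ 2`.
  have h := (integrableOn_rpow_mul_exp_neg_mul_sq (half_pos hb) hs).const_mul
    (Real.exp (c ^ 2 / (2 * b)))
  refine h.mono' (by fun_prop) ?_
  refine (ae_restrict_iff' measurableSet_Ioi).2 (Filter.Eventually.of_forall fun x hx => ?_)
  have hx : 0 < x := hx
  have hxs : 0 < x ^ s := Real.rpow_pos_of_pos hx s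
  rw [Real.norm_of_nonneg (by positivity), mul_left_comm, ← Real.exp_add]
  refine mul_le_mul_of_nonneg_left (Real.exp_le_exp.2 ?_) hxs.le
  have : c ^ 2 / (2 * b) + -(b / 2) * x ^ 2 - (-b * x ^ 2 + c * x) = (c - b * x) ^ 2 / (2 * b) := by
    field_simp; ring
  have h2 : 0 ≤ (c - b * x) ^ 2 / (2 * b) := by positivity
  linarith

theorem aestronglyMeasurable_ofReal_rpow_mul_cexp (s : ℝ) (β γ : ℂ) (m : Measure ℝ) :
    AEStronglyMeasurable
      (fun x : ℝ => ((x ^ s : ℝ) : ℂ) * Complex.exp (-β * x ^ 2 - γ * x)) m := by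
  have h : Measurable fun x : ℝ => ((x ^ s : ℝ) : ℂ) :=
    Complex.measurable_ofReal.comp (measurable_id.pow_const s)
  exact (h.mul (by fun_prop)).aestronglyMeasurable

theorem norm_ofReal_rpow_mul_cexp {x : ℝ} (hx : 0 < x) (s : ℝ) (β γ : ℂ) :
    ‖((x ^ s : ℝ) : ℂ) * Complex.exp (-β * x ^ 2 - γ * x)‖
      = x ^ s * Real.exp (-β.re * x ^ 2 + -γ.re * x) := by
  rw [norm_mul, Complex.norm_exp, Complex.norm_real,
    Real.norm_of_nonneg (Real.rpow_nonneg hx.le s)]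
  congr 2
  rw [← Complex.ofReal_pow]
  simp only [Complex.sub_re, Complex.mul_re, Complex.neg_re, Complex.ofReal_re, Complex.ofReal_im]
  ring

theorem integrableOn_rpow_mul_cexp {β : ℂ} {s : ℝ} (hβ : 0 < β.re) (hs : -1 < s) (γ : ℂ) :
    IntegrableOn (fun x : ℝ => ((x ^ s : ℝ) : ℂ) * Complex.exp (-β * x ^ 2 - γ * x))
      (Set.Ioi 0) := by
  refine (integrableOn_rpow_mul_exp_neg_mul_sq_add hβ hs (-γ.re)).mono'
    (aestronglyMeasurable_ofReal_rpow_mul_cexp s β γ _) ?_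
  refine (ae_restrict_iff' measurableSet_Ioi).2 (Filter.Eventually.of_forall fun x hx => ?_)
  exact (norm_ofReal_rpow_mul_cexp hx s β γ).le

/-- Differentiation under the integral sign: on `Re β > Re β₀ / 2` the derivative is dominated by a
single real Gaussian with two more powers of `x`. This is the holomorphy needed for the identity
theorem. -/
theorem differentiableOn_integral_rpow_mul_cexp {s : ℝ} (hs : -1 < s) :
    DifferentiableOn ℂ
      (fun β : ℂ => ∫ x in Set.Ioi (0 : ℝ), ((x ^ s : ℝ) : ℂ) * Complex.exp (-β * x ^ 2))
      {β | 0 < β.re} := by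
  intro β₀ hβ₀
  have hβ₀ : 0 < β₀.re := hβ₀
  have key := hasDerivAt_integral_of_dominated_loc_of_deriv_le
    (μ := volume.restrict (Set.Ioi (0 : ℝ))) (x₀ := β₀) (s := {β : ℂ | β₀.re / 2 < β.re})
    (F := fun β x => ((x ^ s : ℝ) : ℂ) * Complex.exp (-β * x ^ 2))
    (F' := fun β x => ((x ^ s : ℝ) : ℂ) * (Complex.exp (-β * x ^ 2) * (-(x : ℂ) ^ 2)))
    (bound := fun x => x ^ (s + 2) * Real.exp (-(β₀.re / 2) * x ^ 2))
    ((isOpen_lt continuous_const Complex.continuous_re).mem_nhds (by simp; linarith))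
    (Filter.Eventually.of_forall fun β => by
      simpa using aestronglyMeasurable_ofReal_rpow_mul_cexp s β 0 _)
    (by simpa [IntegrableOn] using integrableOn_rpow_mul_cexp hβ₀ hs 0)
    (by
      have := (aestronglyMeasurable_ofReal_rpow_mul_cexp s β₀ 0
        (volume.restrict (Set.Ioi (0 : ℝ)))).mul
        (show Measurable fun x : ℝ => (-(x : ℂ) ^ 2) by fun_prop).aestronglyMeasurable
      refine this.congr (Filter.Eventually.of_forall fun x => ?_)
      simp [mul_assoc])
    ((ae_restrict_iff' measurableSet_Ioi).2 (Filter.Eventually.of_forall fun x hx β hβ => ?_))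
    (integrableOn_rpow_mul_exp_neg_mul_sq (half_pos hβ₀) (by linarith))
    (Filter.Eventually.of_forall fun x β _ => ?_)
  · exact key.2.differentiableAt.differentiableWithinAt
  · have hx : 0 < x := hx
    have hβ : β₀.re / 2 < β.re := hβ
    have h := norm_ofReal_rpow_mul_cexp hx s β 0
    simp only [zero_mul, sub_zero, Complex.zero_re, neg_zero, add_zero] at h
    rw [← mul_assoc, norm_mul, h, norm_neg, norm_pow, Complex.norm_real,
      Real.norm_of_nonneg hx.le, Real.rpow_add hx, Real.rpow_two, mul_right_comm]
    refine mul_le_mul_of_nonneg_left (Real.exp_le_exp.2 ?_) (by positivity)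
    nlinarith [sq_nonneg x]
  · refine HasDerivAt.const_mul _ (HasDerivAt.cexp ?_)
    simpa using ((hasDerivAt_id β).neg.mul_const ((x : ℂ) ^ 2))

/-- Mellin transform of a complex Gaussian. -/
theorem integral_rpow_mul_cexp_neg_mul_sq {β : ℂ} {s : ℝ} (hβ : 0 < β.re) (hs : 0 < s) :
    ∫ x in Set.Ioi (0 : ℝ), ((x ^ (s - 1) : ℝ) : ℂ) * Complex.exp (-β * x ^ 2)
      = 1 / 2 * Complex.Gamma (s / 2) * β ^ (-(s : ℂ) / 2) := by
  have hopen : IsOpen {β : ℂ | 0 < β.re} := isOpen_lt continuous_const Complex.continuous_re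
  have hpre : IsPreconnected {β : ℂ | 0 < β.re} :=
    (convex_halfSpace_re_gt 0).isPreconnected
  -- Both sides are analytic on the right half-plane and agree on the positive reals, which
  -- accumulate at `1`; the identity theorem does the rest.
  have hF := (differentiableOn_integral_rpow_mul_cexp
    (show -1 < s - 1 by linarith)).analyticOnNhd hopen
  have hG : AnalyticOnNhd ℂ
      (fun β : ℂ => 1 / 2 * Complex.Gamma (s / 2) * β ^ (-(s : ℂ) / 2)) {β | 0 < β.re} := by
    refine DifferentiableOn.analyticOnNhd (fun z hz => ?_) hopen
    have hz : 0 < z.re := hz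
    exact ((differentiableAt_id.cpow_const (Or.inl hz)).const_mul _).differentiableWithinAt
  have hreal : ∀ r : ℝ, 0 < r →
      ∫ x in Set.Ioi (0 : ℝ), ((x ^ (s - 1) : ℝ) : ℂ) * Complex.exp (-(r : ℂ) * x ^ 2)
        = 1 / 2 * Complex.Gamma (s / 2) * (r : ℂ) ^ (-(s : ℂ) / 2) := by
    intro r hr
    have h := integral_rpow_mul_exp_neg_mul_rpow (p := 2) (q := s - 1) (b := r) two_pos
      (by linarith) hr
    have h2 := congrArg (fun t : ℝ => (t : ℂ)) h
    simp only [Real.rpow_two] at h2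
    rw [← integral_complex_ofReal] at h2
    simp only [Complex.ofReal_mul, Complex.ofReal_exp, sub_add_cancel, Complex.ofReal_cpow hr.le,
      ← Complex.Gamma_ofReal] at h2
    push_cast at h2 ⊢
    rw [h2]
    ring
  have hfreq : ∃ᶠ z in nhdsWithin (1 : ℂ) {1}ᶜ,
      (∫ x in Set.Ioi (0 : ℝ), ((x ^ (s - 1) : ℝ) : ℂ) * Complex.exp (-z * x ^ 2))
        = 1 / 2 * Complex.Gamma (s / 2) * z ^ (-(s : ℂ) / 2) := by
    have ht : Filter.Tendsto (fun r : ℝ => (r : ℂ)) (nhdsWithin 1 {1}ᶜ) (nhdsWithin 1 {1}ᶜ) := by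
      refine tendsto_nhdsWithin_iff.2 ⟨?_, ?_⟩
      · exact (Complex.continuous_ofReal.tendsto' 1 1 (by simp)).mono_left nhdsWithin_le_nhds
      · filter_upwards [self_mem_nhdsWithin] with r hr
        simpa using hr
    refine ht.frequently (Filter.Eventually.frequently ?_)
    filter_upwards [nhdsWithin_le_nhds (lt_mem_nhds (zero_lt_one' ℝ))] with r hr
    exact hreal r hr
  exact hF.eqOn_of_preconnected_of_frequently_eq hG hpre (by simp) hfreq hβ

/-- Power series in `γ` of the Mellin transform of `exp (-β x² - γ x)`. -/
theorem hasSum_integral_rpow_mul_cexp {β : ℂ} {s : ℝ} (hβ : 0 < β.re) (hs : 0 < s) (γ : ℂ) :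
    HasSum (fun k : ℕ => (-γ) ^ k / k.factorial *
        (1 / 2 * Complex.Gamma ((s + k) / 2) * β ^ (-((s : ℂ) + k) / 2)))
      (∫ x in Set.Ioi (0 : ℝ), ((x ^ (s - 1) : ℝ) : ℂ) * Complex.exp (-β * x ^ 2 - γ * x)) := by
  have hterm : ∀ k : ℕ, (-γ) ^ k / k.factorial *
        (1 / 2 * Complex.Gamma ((s + k) / 2) * β ^ (-((s : ℂ) + k) / 2))
      = ∫ x in Set.Ioi (0 : ℝ), ((x ^ (s - 1) : ℝ) : ℂ) * Complex.exp (-β * x ^ 2) *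
          ((-γ * x) ^ k / k.factorial) := by
    intro k
    have h := integral_rpow_mul_cexp_neg_mul_sq hβ (show 0 < s + k by positivity)
    push_cast at h
    rw [← h, ← integral_const_mul]
    refine setIntegral_congr_fun measurableSet_Ioi fun x hx => ?_
    have hx : 0 < x := hx
    have : x ^ (s + k - 1) = x ^ (s - 1) * x ^ k := by
      rw [← Real.rpow_natCast, ← Real.rpow_add hx]; ring_nf
    simp only [this, mul_pow]
    push_cast
    ring
  simp only [hterm]
  have hexp : ∀ y : ℝ, HasSum (fun k : ℕ => y ^ k / k.factorial) (Real.exp y) := fun y => by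
    rw [Real.exp_eq_exp_ℝ]; exact NormedSpace.expSeries_div_hasSum_exp y
  have hcexp : ∀ y : ℂ, HasSum (fun k : ℕ => y ^ k / k.factorial) (Complex.exp y) := fun y => by
    rw [Complex.exp_eq_exp_ℂ]; exact NormedSpace.expSeries_div_hasSum_exp y
  -- The bounds sum to `x ^ (s - 1) * exp (-β.re * x ^ 2 + ‖γ‖ * x)`, which is integrable.
  refine hasSum_integral_of_dominated_convergence
    (fun (k : ℕ) (x : ℝ) => x ^ (s - 1) * Real.exp (-β.re * x ^ 2) * ((‖γ‖ * x) ^ k / k.factorial))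
    (fun k => ?_) (fun k => ?_) ?_ ?_ ?_
  · refine AEStronglyMeasurable.mul ?_ (Measurable.aestronglyMeasurable (by fun_prop))
    simpa using aestronglyMeasurable_ofReal_rpow_mul_cexp (s - 1) β 0 _
  · refine (ae_restrict_iff' measurableSet_Ioi).2 (Filter.Eventually.of_forall fun x hx => ?_)
    have hx : 0 < x := hx
    have h := norm_ofReal_rpow_mul_cexp hx (s - 1) β 0
    simp only [zero_mul, sub_zero, Complex.zero_re, neg_zero, add_zero] at h
    rw [norm_mul, h]
    simp [abs_of_pos hx]
  · exact Filter.Eventually.of_forall fun x => (hexp _).summable.mul_left _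
  · refine (integrableOn_rpow_mul_exp_neg_mul_sq_add hβ (show -1 < s - 1 by linarith)
      ‖γ‖).congr_fun (fun x _ => ?_) measurableSet_Ioi
    simp only
    rw [tsum_mul_left, (hexp _).tsum_eq, mul_assoc, ← Real.exp_add]
  · refine Filter.Eventually.of_forall fun x => ?_
    have h := (hcexp (-γ * x)).mul_left (((x ^ (s - 1) : ℝ) : ℂ) * Complex.exp (-β * x ^ 2))
    rw [mul_assoc, ← Complex.exp_add] at h
    rwa [show -β * (x : ℂ) ^ 2 - γ * x = -β * (x : ℂ) ^ 2 + -γ * x by ring]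

/-! ### From the power series to Kummer and parabolic cylinder functions -/

/-- The even terms of the exponential series thus acquire the Kummer parameter `1 / 2`; the odd
analogue below yields `3 / 2`. -/
theorem factorial_two_mul_eq_ascPochhammer (j : ℕ) :
    ((2 * j).factorial : ℂ) = 4 ^ j * ((ascPochhammer ℂ j).eval (1 / 2) * j.factorial) := by
  induction j with
  | zero => simp
  | succ j ih =>
    rw [show 2 * (j + 1) = 2 * j + 1 + 1 by ring, Nat.factorial_succ, Nat.factorial_succ,
      ascPochhammer_succ_eval, Nat.factorial_succ]
    push_cast
    rw [ih]
    ring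

theorem factorial_two_mul_add_one_eq_ascPochhammer (j : ℕ) :
    ((2 * j + 1).factorial : ℂ) = 4 ^ j * ((ascPochhammer ℂ j).eval (3 / 2) * j.factorial) := by
  induction j with
  | zero => simp
  | succ j ih =>
    rw [show 2 * (j + 1) + 1 = 2 * j + 1 + 1 + 1 by ring, Nat.factorial_succ (2 * j + 1 + 1),
      Nat.factorial_succ (2 * j + 1), ascPochhammer_succ_eval, Nat.factorial_succ j]
    push_cast
    rw [ih]
    ring

theorem Gamma_add_natCast_eq_ascPochhammer {z : ℂ} (hz : 0 < z.re) (j : ℕ) :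
    Complex.Gamma (z + j) = Complex.Gamma z * (ascPochhammer ℂ j).eval z := by
  rw [← Complex.Gamma_add_nat_div_Gamma_eq z, mul_div_cancel₀ _ (Complex.Gamma_ne_zero_of_re_pos hz)]
  rintro k rfl
  simp at hz
  linarith [(Nat.cast_nonneg k : (0 : ℝ) ≤ k)]

/-- A positive real factor leaves the argument unchanged, so the principal logarithm is additive
here. -/
theorem ofReal_mul_cpow {r : ℝ} (hr : 0 < r) {z : ℂ} (hz : z ≠ 0) (c : ℂ) :
    ((r : ℂ) * z) ^ c = (r : ℂ) ^ c * z ^ c := by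
  have hr' : (r : ℂ) ≠ 0 := Complex.ofReal_ne_zero.2 hr.ne'
  rw [Complex.cpow_def_of_ne_zero (mul_ne_zero hr' hz), Complex.cpow_def_of_ne_zero hr',
    Complex.cpow_def_of_ne_zero hz, Complex.log_ofReal_mul hr hz, ← Complex.exp_add,
    Complex.ofReal_log hr.le, add_mul]

theorem cpow_neg_sub_natCast {β : ℂ} (hβ : β ≠ 0) (c : ℂ) (j : ℕ) :
    β ^ (-c - j) = β ^ (-c) / β ^ j := by
  rw [Complex.cpow_sub _ _ hβ, Complex.cpow_natCast]

theorem gaussian_mellin_term_even {β : ℂ} {s : ℝ} (hβ : β ≠ 0) (hs : 0 < s) (γ : ℂ) (j : ℕ) :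
    (-γ) ^ (2 * j) / (2 * j).factorial *
        (1 / 2 * Complex.Gamma ((s + (2 * j : ℕ)) / 2) * β ^ (-((s : ℂ) + (2 * j : ℕ)) / 2))
      = 1 / 2 * Complex.Gamma (s / 2) * β ^ (-((s : ℂ) / 2))
        * ((ascPochhammer ℂ j).eval (s / 2 : ℂ) / ((ascPochhammer ℂ j).eval (1 / 2)
          * (j.factorial : ℂ)) * (γ ^ 2 / (4 * β)) ^ j) := by
  push_cast
  rw [show ((s : ℂ) + 2 * j) / 2 = s / 2 + j by ring,
    Gamma_add_natCast_eq_ascPochhammer (by simpa using hs),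
    show -((s : ℂ) + 2 * j) / 2 = -((s : ℂ) / 2) - j by ring, cpow_neg_sub_natCast hβ,
    factorial_two_mul_eq_ascPochhammer, pow_mul, neg_sq, div_pow, mul_pow]
  ring

theorem gaussian_mellin_term_odd {β : ℂ} {s : ℝ} (hβ : β ≠ 0) (hs : 0 < s) (γ : ℂ) (j : ℕ) :
    (-γ) ^ (2 * j + 1) / (2 * j + 1).factorial *
        (1 / 2 * Complex.Gamma ((s + (2 * j + 1 : ℕ)) / 2)
          * β ^ (-((s : ℂ) + (2 * j + 1 : ℕ)) / 2))
      = -(γ / 2 * Complex.Gamma ((1 + s) / 2) * β ^ (-(((1 : ℂ) + s) / 2)))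
        * ((ascPochhammer ℂ j).eval ((1 + s) / 2 : ℂ) / ((ascPochhammer ℂ j).eval (3 / 2)
          * (j.factorial : ℂ)) * (γ ^ 2 / (4 * β)) ^ j) := by
  push_cast
  rw [show ((s : ℂ) + (2 * j + 1)) / 2 = (1 + s) / 2 + j by ring,
    Gamma_add_natCast_eq_ascPochhammer (by simp; linarith),
    show -((s : ℂ) + (2 * j + 1)) / 2 = -(((1 : ℂ) + s) / 2) - j by ring, cpow_neg_sub_natCast hβ,
    factorial_two_mul_add_one_eq_ascPochhammer, pow_succ, pow_mul, neg_sq, div_pow, mul_pow]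
  ring

theorem HasSum.eq_mul_tsum_add_mul_tsum {F f g : ℕ → ℂ} {S A B : ℂ} (h : HasSum F S)
    (hf : ∀ j, F (2 * j) = A * f j) (hg : ∀ j, F (2 * j + 1) = B * g j) :
    S = A * ∑' j, f j + B * ∑' j, g j := by
  have heven : Summable fun j => F (2 * j) :=
    h.summable.comp_injective (mul_right_injective₀ (two_ne_zero' ℕ))
  have hodd : Summable fun j => F (2 * j + 1) :=
    h.summable.comp_injective (i := fun j : ℕ => 2 * j + 1) fun i j hij => by simpa using hij
  rw [← h.tsum_eq, ← tsum_even_add_odd heven hodd, ← tsum_mul_left, ← tsum_mul_left]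
  simp only [hf, hg]

/-- The Mellin transform of `exp (-β x² - γ x)` as a combination of two Kummer functions. -/
theorem integral_rpow_mul_cexp_eq_kummerM {β : ℂ} {s : ℝ} (hβ : 0 < β.re) (hs : 0 < s) (γ : ℂ) :
    ∫ x in Set.Ioi (0 : ℝ), ((x ^ (s - 1) : ℝ) : ℂ) * Complex.exp (-β * x ^ 2 - γ * x)
      = 1 / 2 * Complex.Gamma (s / 2) * β ^ (-((s : ℂ) / 2))
          * kummerM (s / 2) (1 / 2) (γ ^ 2 / (4 * β))
        + -(γ / 2 * Complex.Gamma ((1 + s) / 2) * β ^ (-(((1 : ℂ) + s) / 2)))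
          * kummerM ((1 + s) / 2) (3 / 2) (γ ^ 2 / (4 * β)) := by
  have h := hasSum_integral_rpow_mul_cexp hβ hs γ
  have hβ0 : β ≠ 0 := by rintro rfl; simp at hβ
  exact h.eq_mul_tsum_add_mul_tsum (gaussian_mellin_term_even hβ0 hs γ)
    (gaussian_mellin_term_odd hβ0 hs γ)

/-- Integral representation of the parabolic cylinder function `D_{-s}`. -/
theorem integral_rpow_mul_cexp_eq_parabolicCylinderD {β : ℂ} {s : ℝ} (hβ : 0 < β.re) (hs : 0 < s)
    (γ : ℂ) :
    ∫ x in Set.Ioi (0 : ℝ), ((x ^ (s - 1) : ℝ) : ℂ) * Complex.exp (-β * x ^ 2 - γ * x)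
      = (2 * β) ^ (-((s : ℂ) / 2)) * Complex.Gamma s * Complex.exp (γ ^ 2 / (8 * β))
          * parabolicCylinderD (-s) (γ * (2 * β) ^ (-(1 / 2) : ℂ)) := by
  have hβ0 : β ≠ 0 := by rintro rfl; simp at hβ
  have hmul : ∀ c : ℂ, (2 * β) ^ c = 2 ^ c * β ^ c := fun c => by
    simpa using ofReal_mul_cpow two_pos hβ0 c
  have hz2 : (γ * (2 * β) ^ (-(1 / 2) : ℂ)) ^ 2 = γ ^ 2 / (2 * β) := by
    rw [mul_pow, ← Complex.cpow_nat_mul]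
    norm_num [Complex.cpow_neg_one]
    ring
  have hG1 : Complex.Gamma ((s : ℂ) / 2) ≠ 0 :=
    Complex.Gamma_ne_zero_of_re_pos (by simpa using hs)
  have hG2 : Complex.Gamma (((1 : ℂ) + s) / 2) ≠ 0 :=
    Complex.Gamma_ne_zero_of_re_pos (by simp; linarith)
  -- Legendre duplication, with `2 ^ (1 - s)` written through the factor `2 ^ (-(s / 2))` that
  -- occurs both in `D_{-s}` and in `(2 * β) ^ (-(s / 2))`.
  have hdup : Complex.Gamma ((s : ℂ) / 2) * Complex.Gamma (((1 : ℂ) + s) / 2)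
      = Complex.Gamma s * (2 * (2 ^ (-((s : ℂ) / 2))) ^ 2) * (Real.sqrt Real.pi : ℂ) := by
    have h := Complex.Gamma_mul_Gamma_add_half ((s : ℂ) / 2)
    rw [show (s : ℂ) / 2 + 1 / 2 = (1 + s) / 2 by ring, show 2 * ((s : ℂ) / 2) = s by ring,
      sub_eq_add_neg, Complex.cpow_add _ _ two_ne_zero, Complex.cpow_one] at h
    rw [h, ← Complex.cpow_nat_mul]
    congr 4
    push_cast
    ring
  have hpi : (Real.sqrt Real.pi : ℂ) ≠ 0 := by
    exact_mod_cast (Real.sqrt_pos.2 Real.pi_pos).ne'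
  have hsqrt : (Real.sqrt (2 * Real.pi) : ℂ) * 2 ^ (-(1 / 2) : ℂ) = (Real.sqrt Real.pi : ℂ) := by
    rw [Real.sqrt_mul zero_le_two, Complex.cpow_neg]
    have : (2 : ℂ) ^ (1 / 2 : ℂ) = (Real.sqrt 2 : ℂ) := by
      rw [Real.sqrt_eq_rpow, Complex.ofReal_cpow zero_le_two]; push_cast; rfl
    rw [this]
    have : (Real.sqrt 2 : ℂ) ≠ 0 := by exact_mod_cast (Real.sqrt_pos.2 two_pos).ne'
    push_cast
    field_simp
  have hβpow : β ^ (-(((1 : ℂ) + s) / 2)) = β ^ (-((s : ℂ) / 2)) * β ^ (-(1 / 2) : ℂ) := by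
    rw [← Complex.cpow_add _ _ hβ0]; ring_nf
  -- The prefactor exactly cancels the `exp (-z ^ 2 / 4)` built into `D_{-s}`.
  have hexp : Complex.exp (γ ^ 2 / (8 * β)) * Complex.exp (-(γ ^ 2 / (2 * β)) / 4) = 1 := by
    rw [← Complex.exp_add, Complex.exp_eq_one_iff]
    exact ⟨0, by field_simp; ring⟩
  rw [integral_rpow_mul_cexp_eq_kummerM hβ hs, parabolicCylinderD, hz2,
    show γ ^ 2 / (2 * β) / 2 = γ ^ 2 / (4 * β) by field_simp; norm_num, hmul, hmul, hβpow]
  simp only [neg_neg, sub_neg_eq_add, neg_div]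
  generalize Complex.Gamma ((s : ℂ) / 2) = G1 at *
  generalize Complex.Gamma (((1 : ℂ) + s) / 2) = G2 at *
  generalize kummerM _ _ _ = K1
  generalize kummerM _ _ _ = K2
  generalize (2 : ℂ) ^ (-((s : ℂ) / 2)) = t at *
  generalize β ^ (-((s : ℂ) / 2)) = u at *
  rw [neg_div] at hexp
  generalize Complex.exp (γ ^ 2 / (8 * β)) = e at *
  generalize Complex.exp (-(γ ^ 2 / (2 * β) / 4)) = f at *
  generalize β ^ (-(1 / 2) : ℂ) = v at *
  generalize Complex.Gamma (s : ℂ) = g at *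
  -- Duplication turns each reciprocal Gamma factor of `D_{-s}` into the other Gamma factor, as the
  -- Kummer form of the integral requires.
  have hA : g * t ^ 2 * (Real.sqrt Real.pi : ℂ) / G2 = G1 / 2 := by
    field_simp; linear_combination -hdup
  have hB : g * t ^ 2 * (Real.sqrt Real.pi : ℂ) / G1 = G2 / 2 := by
    field_simp; linear_combination -hdup
  linear_combination (-u * K1 * e * f) * hA + (γ * u * v * K2 * e * f) * hB
    + (g * t ^ 2 * u * e * f * γ * v / G1 * K2) * hsqrt
    + (γ * G2 / 2 * u * v * K2 - G1 / 2 * u * K1) * hexp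

/-! ### Expansion of the wave function and the tomogram amplitude -/

theorem Real.Gamma_add_natCast_eq_ascPochhammer {x : ℝ} (hx : 0 < x) (j : ℕ) :
    Real.Gamma (x + j) = Real.Gamma x * (ascPochhammer ℝ j).eval x := by
  induction j with
  | zero => simp
  | succ j ih =>
    rw [ascPochhammer_succ_eval, Nat.cast_succ, ← add_assoc,
      Real.Gamma_add_one (by positivity), ih]
    ring

theorem ascPochhammer_eval_neg_natCast {n k : ℕ} (hk : k ≤ n) :
    (ascPochhammer ℝ k).eval (-(n : ℝ)) = (-1) ^ k * (n.factorial / (n - k).factorial) := by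
  rw [ascPochhammer_eval_neg_eq_descPochhammer, descPochhammer_eval_eq_descFactorial,
    ← Nat.factorial_mul_descFactorial hk]
  have : ((n - k).factorial : ℝ) ≠ 0 := Nat.cast_ne_zero.2 (Nat.factorial_ne_zero _)
  push_cast
  field_simp

theorem laguerreL_eq_sum_ascPochhammer (n : ℕ) {α : ℝ} (hα : -1 < α) (x : ℝ) :
    laguerreL n α x = (ascPochhammer ℝ n).eval (α + 1) / n.factorial *
      ∑ k ∈ Finset.range (n + 1), (ascPochhammer ℝ k).eval (-(n : ℝ)) /
        ((ascPochhammer ℝ k).eval (α + 1) * k.factorial) * x ^ k := by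
  have hα1 : 0 < α + 1 := by linarith
  rw [laguerreL, Finset.mul_sum]
  refine Finset.sum_congr rfl fun k hk => ?_
  have hkn : k ≤ n := Nat.lt_succ_iff.1 (Finset.mem_range.1 hk)
  have hG := (Real.Gamma_pos_of_pos hα1).ne'
  have hP := (ascPochhammer_pos k (α + 1) hα1).ne'
  rw [ascPochhammer_eval_neg_natCast hkn, show (n : ℝ) + α + 1 = α + 1 + n by ring,
    show α + k + 1 = α + 1 + k by ring, Real.Gamma_add_natCast_eq_ascPochhammer hα1,
    Real.Gamma_add_natCast_eq_ascPochhammer hα1]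
  have h1 : (n.factorial : ℝ) ≠ 0 := Nat.cast_ne_zero.2 (Nat.factorial_ne_zero _)
  field_simp

theorem phoB_nonneg (a : ℝ) : 0 ≤ phoB a := by unfold phoB; positivity

/-- Quadratic coefficient of the exponent in the tomogram integrand. -/
noncomputable def phoBeta (xω μ ν : ℝ) : ℂ := 1 / (2 * (xω : ℂ) ^ 2) - Complex.I * μ / (2 * ν)

theorem phoBeta_re (xω μ ν : ℝ) : (phoBeta xω μ ν).re = 1 / (2 * xω ^ 2) := by
  have : phoBeta xω μ ν
      = ((1 / (2 * xω ^ 2) : ℝ) : ℂ) - ((μ / (2 * ν) : ℝ) : ℂ) * Complex.I := by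
    unfold phoBeta; push_cast; ring
  rw [this]
  simp only [Complex.sub_re, Complex.ofReal_re, Complex.re_ofReal_mul, Complex.I_re, mul_zero,
    sub_zero]

theorem phoBeta_re_pos {xω : ℝ} (hxω : 0 < xω) (μ ν : ℝ) : 0 < (phoBeta xω μ ν).re := by
  rw [phoBeta_re]; positivity

/-- Coefficient of the `k`-th power in the wave function. -/
noncomputable def phoCoeff (a : ℝ) (n : ℕ) (xω : ℝ) (k : ℕ) : ℝ :=
  1 / Real.sqrt xω * Real.sqrt (2 * n.factorial / Real.Gamma (n + phoB a + 1)) *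
    ((ascPochhammer ℝ n).eval (phoB a + 1) / n.factorial) *
    ((ascPochhammer ℝ k).eval (-(n : ℝ)) /
        ((ascPochhammer ℝ k).eval (phoB a + 1) * k.factorial)) *
    xω ^ (-(2 * k + phoB a + 1 / 2))

/-- The exponent of `x` is kept in the form `s - 1`, `s = 2 * k + b + 3 / 2`, to fit the Mellin
formula. -/
theorem phoWave_of_pos (a : ℝ) (n : ℕ) {xω x : ℝ} (hxω : 0 < xω) (hx : 0 < x) :
    phoWave a n xω x = ∑ k ∈ Finset.range (n + 1), phoCoeff a n xω k *
      (x ^ (2 * k + phoB a + 3 / 2 - 1) * Real.exp (-(1 / 2) * (x ^ 2 / xω ^ 2))) := by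
  rw [phoWave, if_pos hx, laguerreL_eq_sum_ascPochhammer n
    (lt_of_lt_of_le neg_one_lt_zero (phoB_nonneg a)), Finset.mul_sum, Finset.mul_sum]
  refine Finset.sum_congr rfl fun k _ => ?_
  have h : (x / xω) ^ (phoB a + 1 / 2) * (x ^ 2 / xω ^ 2) ^ k
      = x ^ (2 * k + phoB a + 3 / 2 - 1) * xω ^ (-(2 * k + phoB a + 1 / 2)) := by
    have hpow : (x ^ 2 / xω ^ 2) ^ k = (x / xω) ^ ((2 * k : ℕ) : ℝ) := by
      rw [Real.rpow_natCast, pow_mul, div_pow x]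
    rw [hpow, ← Real.rpow_add (div_pos hx hxω), Real.div_rpow hx.le hxω.le, Real.rpow_neg hxω.le,
      div_eq_mul_inv]
    push_cast
    ring_nf
  unfold phoCoeff
  linear_combination (1 / Real.sqrt xω *
    Real.sqrt (2 * n.factorial / Real.Gamma (n + phoB a + 1)) *
    ((ascPochhammer ℝ n).eval (phoB a + 1) / n.factorial) *
    ((ascPochhammer ℝ k).eval (-(n : ℝ)) /
        ((ascPochhammer ℝ k).eval (phoB a + 1) * k.factorial)) *
    Real.exp (-(1 / 2) * (x ^ 2 / xω ^ 2))) * h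

theorem tomogramIntegrand_of_pos (a : ℝ) (n : ℕ) {xω y : ℝ} (hxω : 0 < xω) (hy : 0 < y)
    (μ ν X : ℝ) :
    tomogramIntegrand (fun t => (phoWave a n xω t : ℂ)) μ ν X y
      = ∑ k ∈ Finset.range (n + 1), (phoCoeff a n xω k : ℂ) *
        (((y ^ (2 * k + phoB a + 3 / 2 - 1) : ℝ) : ℂ) *
          Complex.exp (-phoBeta xω μ ν * y ^ 2 - Complex.I * X / ν * y)) := by
  have hexp : Complex.exp (-phoBeta xω μ ν * y ^ 2 - Complex.I * X / ν * y)
      = (Real.exp (-(1 / 2) * (y ^ 2 / xω ^ 2)) : ℂ) *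
        Complex.exp (Complex.I * μ / (2 * ν) * y ^ 2 - Complex.I * X / ν * y) := by
    rw [Complex.ofReal_exp, ← Complex.exp_add]
    congr 1
    unfold phoBeta
    push_cast
    ring
  rw [tomogramIntegrand, phoWave_of_pos a n hxω hy, hexp, Complex.ofReal_sum, Finset.sum_mul]
  refine Finset.sum_congr rfl fun k _ => ?_
  push_cast
  ring

theorem tomogramIntegrand_of_nonpos (a : ℝ) (n : ℕ) (xω : ℝ) {y : ℝ} (hy : ¬ 0 < y)
    (μ ν X : ℝ) :
    tomogramIntegrand (fun t => (phoWave a n xω t : ℂ)) μ ν X y = 0 := by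
  simp [tomogramIntegrand, phoWave, hy]

theorem integrable_tomogramIntegrand (a : ℝ) (n : ℕ) {xω : ℝ} (hxω : 0 < xω) (μ ν X : ℝ) :
    Integrable (fun y : ℝ => tomogramIntegrand (fun t => (phoWave a n xω t : ℂ)) μ ν X y) := by
  have hsupp : Function.support
      (fun y : ℝ => tomogramIntegrand (fun t => (phoWave a n xω t : ℂ)) μ ν X y)
        ⊆ Set.Ioi 0 := by
    intro y hy
    by_contra h
    exact hy (tomogramIntegrand_of_nonpos a n xω h μ ν X)
  rw [← integrableOn_iff_integrable_of_support_subset hsupp]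
  have hsum : IntegrableOn (fun y : ℝ => ∑ k ∈ Finset.range (n + 1), (phoCoeff a n xω k : ℂ) *
        (((y ^ (2 * k + phoB a + 3 / 2 - 1) : ℝ) : ℂ) *
          Complex.exp (-phoBeta xω μ ν * y ^ 2 - Complex.I * X / ν * y))) (Set.Ioi 0) := by
    refine integrable_finsetSum _ fun k _ => Integrable.const_mul ?_ _
    exact integrableOn_rpow_mul_cexp (phoBeta_re_pos hxω μ ν)
      (by have := phoB_nonneg a; have : (0 : ℝ) ≤ k := k.cast_nonneg; linarith) _
  exact hsum.congr_fun
    (fun y hy => (tomogramIntegrand_of_pos a n hxω hy μ ν X).symm) measurableSet_Ioi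

theorem integral_tomogramIntegrand (a : ℝ) (n : ℕ) {xω : ℝ} (hxω : 0 < xω) (μ ν X : ℝ) :
    ∫ y : ℝ, tomogramIntegrand (fun t => (phoWave a n xω t : ℂ)) μ ν X y
      = ∑ k ∈ Finset.range (n + 1), (phoCoeff a n xω k : ℂ) *
        ((2 * phoBeta xω μ ν) ^ (-(((2 * k + phoB a + 3 / 2 : ℝ) : ℂ) / 2))
          * Complex.Gamma ((2 * k + phoB a + 3 / 2 : ℝ) : ℂ)
          * Complex.exp ((Complex.I * X / ν) ^ 2 / (8 * phoBeta xω μ ν))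
          * parabolicCylinderD (-((2 * k + phoB a + 3 / 2 : ℝ) : ℂ))
            (Complex.I * X / ν * (2 * phoBeta xω μ ν) ^ (-(1 / 2) : ℂ))) := by
  rw [← setIntegral_eq_integral_of_forall_compl_eq_zero (s := Set.Ioi 0)
    fun y hy => tomogramIntegrand_of_nonpos a n xω hy μ ν X,
    setIntegral_congr_fun measurableSet_Ioi
      fun y hy => tomogramIntegrand_of_pos a n hxω hy μ ν X]
  have hs : ∀ k : ℕ, 0 < 2 * k + phoB a + 3 / 2 := fun k => by
    have := phoB_nonneg a; positivity
  rw [integral_finsetSum]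
  · refine Finset.sum_congr rfl fun k _ => ?_
    rw [integral_const_mul,
      integral_rpow_mul_cexp_eq_parabolicCylinderD (phoBeta_re_pos hxω μ ν) (hs k)]
  · exact fun k _ => Integrable.const_mul
      (integrableOn_rpow_mul_cexp (phoBeta_re_pos hxω μ ν) (by linarith [hs k]) _) _

/-! ### Branches, argument and Gaussian prefactor -/

theorem two_mul_phoBeta {xω ν : ℝ} (hxω : 0 < xω) (hν : ν ≠ 0) (μ : ℝ) :
    2 * phoBeta xω μ ν
      = ((1 / xω ^ 2 : ℝ) : ℂ) * (((ν : ℂ) - Complex.I * μ * xω ^ 2) / ν) := by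
  have h1 : (xω : ℂ) ≠ 0 := Complex.ofReal_ne_zero.2 hxω.ne'
  have h2 : (ν : ℂ) ≠ 0 := Complex.ofReal_ne_zero.2 hν
  unfold phoBeta
  push_cast
  field_simp

/-- The number being conjugated has real part `|ν| > 0`, so its principal powers commute with
conjugation, and both signs of `ν` are treated at once. -/
theorem phoRatio_eq_conj {ν : ℝ} (hν : ν ≠ 0) (xω μ : ℝ) :
    ((ν : ℂ) - Complex.I * μ * xω ^ 2) / ν = ((1 / |ν| : ℝ) : ℂ) *
      (starRingEnd ℂ) ((|ν| : ℝ) + Complex.I * ν.sign * μ * xω ^ 2) := by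
  have h2 : (ν : ℂ) ≠ 0 := Complex.ofReal_ne_zero.2 hν
  simp only [map_add, map_mul, map_pow, Complex.conj_ofReal, Complex.conj_I]
  rcases lt_or_gt_of_ne hν with h | h
  · rw [abs_of_neg h, Real.sign_of_neg h]
    push_cast
    field_simp
    ring
  · rw [abs_of_pos h, Real.sign_of_pos h]
    push_cast
    field_simp
    ring

theorem re_abs_add_pos {ν : ℝ} (hν : ν ≠ 0) (xω μ : ℝ) :
    0 < (((|ν| : ℝ) : ℂ) + Complex.I * ν.sign * μ * xω ^ 2).re := by
  have : Complex.I * (ν.sign : ℂ) * μ * (xω : ℂ) ^ 2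
      = ((ν.sign * μ * xω ^ 2 : ℝ) : ℂ) * Complex.I := by push_cast; ring
  rw [this]
  simpa only [Complex.add_re, Complex.ofReal_re, Complex.re_ofReal_mul, Complex.I_re, mul_zero,
    add_zero] using abs_pos.2 hν

theorem phoRatio_ne_zero {ν : ℝ} (hν : ν ≠ 0) (xω μ : ℝ) :
    ((ν : ℂ) - Complex.I * μ * xω ^ 2) / ν ≠ 0 := by
  have hre := re_abs_add_pos hν xω μ
  rw [phoRatio_eq_conj hν]
  refine mul_ne_zero (Complex.ofReal_ne_zero.2 (by simpa using hν)) ?_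
  rw [Ne, map_eq_zero]
  intro h
  rw [h] at hre
  simp at hre

theorem norm_sq_abs_add {ν : ℝ} (hν : ν ≠ 0) (xω μ : ℝ) :
    ‖((|ν| : ℝ) : ℂ) + Complex.I * ν.sign * μ * xω ^ 2‖ ^ 2 = ν ^ 2 + μ ^ 2 * xω ^ 4 := by
  have : Complex.I * (ν.sign : ℂ) * μ * (xω : ℂ) ^ 2
      = ((ν.sign * μ * xω ^ 2 : ℝ) : ℂ) * Complex.I := by push_cast; ring
  have hs : ν.sign ^ 2 = 1 := by
    rcases lt_or_gt_of_ne hν with h | h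
    · rw [Real.sign_of_neg h]; norm_num
    · rw [Real.sign_of_pos h]; norm_num
  rw [this, Complex.sq_norm, Complex.normSq_add_mul_I, sq_abs]
  linear_combination μ ^ 2 * xω ^ 4 * hs

theorem arg_ne_pi_of_re_pos {w : ℂ} (hw : 0 < w.re) : w.arg ≠ Real.pi := by
  intro h
  have := (Complex.arg_eq_pi_iff.1 h).1
  linarith

/-- With `w = |ν| + I * sign ν * μ * xω ^ 2`, `2 * β` is `conj w / (xω ^ 2 * |ν|)`. The inverse root
of `conj w` is `√w / |w|`, and `√|ν| / ν = sign ν / √|ν|` produces the sign. -/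
theorem phoArg_eq {xω ν : ℝ} (hxω : 0 < xω) (hν : ν ≠ 0) (μ X : ℝ) :
    Complex.I * X / ν * (2 * phoBeta xω μ ν) ^ (-(1 / 2) : ℂ) = phoArg xω μ ν X := by
  have hre := re_abs_add_pos hν xω μ
  have hnorm := norm_sq_abs_add hν xω μ
  rw [two_mul_phoBeta hxω hν, phoRatio_eq_conj hν, phoArg]
  generalize ((|ν| : ℝ) : ℂ) + Complex.I * ν.sign * μ * xω ^ 2 = w at *
  have hw : w ≠ 0 := by rintro rfl; simp at hre
  have hcw : (starRingEnd ℂ) w ≠ 0 := by simpa using hw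
  have hν' : 0 < |ν| := abs_pos.2 hν
  have hνr : ((1 / |ν| : ℝ) : ℂ) ≠ 0 := Complex.ofReal_ne_zero.2 (by positivity)
  rw [ofReal_mul_cpow (by positivity) (mul_ne_zero hνr hcw), ofReal_mul_cpow (by positivity) hcw]
  have h1 : (((1 / xω ^ 2 : ℝ) : ℂ)) ^ (-(1 / 2) : ℂ) = (xω : ℂ) := by
    rw [show (-(1 / 2) : ℂ) = ((-(1 / 2) : ℝ) : ℂ) by push_cast; rfl,
      ← Complex.ofReal_cpow (by positivity), one_div, Real.inv_rpow (by positivity),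
      Real.rpow_neg (by positivity), inv_inv, ← Real.sqrt_eq_rpow, Real.sqrt_sq hxω.le]
  have h2 : (((1 / |ν| : ℝ) : ℂ)) ^ (-(1 / 2) : ℂ) = (Real.sqrt |ν| : ℂ) := by
    rw [show (-(1 / 2) : ℂ) = ((-(1 / 2) : ℝ) : ℂ) by push_cast; rfl,
      ← Complex.ofReal_cpow (by positivity), one_div |ν|, Real.inv_rpow (by positivity),
      Real.rpow_neg (by positivity), inv_inv, ← Real.sqrt_eq_rpow]
  have hhalf : (starRingEnd ℂ) w ^ (1 / 2 : ℂ) = (starRingEnd ℂ) (w ^ (1 / 2 : ℂ)) := by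
    rw [Complex.conj_cpow _ _ (arg_ne_pi_of_re_pos hre), map_div₀, map_one, map_ofNat]
  have hsq : ‖w ^ (1 / 2 : ℂ)‖ ^ 2 = Real.sqrt (ν ^ 2 + μ ^ 2 * xω ^ 4) := by
    rw [← norm_pow, ← Complex.cpow_nat_mul, ← hnorm, Real.sqrt_sq (norm_nonneg w)]
    norm_num
  have h3 : (starRingEnd ℂ) w ^ (-(1 / 2) : ℂ)
      = w ^ (1 / 2 : ℂ) / (Real.sqrt (ν ^ 2 + μ ^ 2 * xω ^ 4) : ℂ) := by
    have hw2 : w ^ (1 / 2 : ℂ) ≠ 0 := by simp [Complex.cpow_eq_zero_iff, hw]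
    have hcw2 : (starRingEnd ℂ) (w ^ (1 / 2 : ℂ)) ≠ 0 := by
      rwa [Ne, map_eq_zero]
    rw [Complex.cpow_neg, hhalf, ← hsq]
    push_cast
    rw [← Complex.mul_conj']
    field_simp
  rw [h1, h2, h3]
  have hsr : (Real.sqrt |ν| : ℂ) ≠ 0 := by exact_mod_cast (Real.sqrt_pos.2 hν').ne'
  have hν2 : (ν : ℂ) ≠ 0 := Complex.ofReal_ne_zero.2 hν
  have hsgn : (ν.sign : ℂ) * ν = (Real.sqrt |ν| : ℂ) ^ 2 := by
    rw [← Complex.ofReal_pow, Real.sq_sqrt hν'.le, ← Complex.ofReal_mul]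
    congr 1
    rcases lt_or_gt_of_ne hν with h | h
    · rw [Real.sign_of_neg h, abs_of_neg h]; ring
    · rw [Real.sign_of_pos h, abs_of_pos h]; ring
  have hsgn2 : (Real.sqrt |ν| : ℂ) / ν = ν.sign / (Real.sqrt |ν| : ℂ) := by
    rw [div_eq_div_iff hν2 hsr, hsgn, sq]
  linear_combination (Complex.I * X * xω * w ^ (1 / 2 : ℂ) /
    (Real.sqrt (ν ^ 2 + μ ^ 2 * xω ^ 4) : ℂ)) * hsgn2

/-- Only the real part of the exponent matters; rationalising the denominator shows that `ν` cancels
from it. -/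
theorem norm_cexp_phoBeta_sq {xω ν : ℝ} (hxω : 0 < xω) (hν : ν ≠ 0) (μ X : ℝ) :
    ‖Complex.exp ((Complex.I * X / ν) ^ 2 / (8 * phoBeta xω μ ν))‖ ^ 2
      = Real.exp (-(X ^ 2 * xω ^ 2 / (2 * (ν ^ 2 + μ ^ 2 * xω ^ 4)))) := by
  have hN : 0 < ν ^ 2 + μ ^ 2 * xω ^ 4 := by positivity
  have hNc : (ν : ℂ) ^ 2 + μ ^ 2 * xω ^ 4 ≠ 0 := by exact_mod_cast hN.ne'
  have h1 : (xω : ℂ) ≠ 0 := Complex.ofReal_ne_zero.2 hxω.ne'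
  have h2 : (ν : ℂ) ≠ 0 := Complex.ofReal_ne_zero.2 hν
  have hfac : ((ν : ℂ) - Complex.I * μ * xω ^ 2) * (ν + Complex.I * μ * xω ^ 2)
      = ν ^ 2 + μ ^ 2 * xω ^ 4 := by
    linear_combination (-(μ : ℂ) ^ 2 * xω ^ 4) * Complex.I_sq
  have h3 : (ν : ℂ) - Complex.I * μ * xω ^ 2 ≠ 0 := fun h => hNc (by rw [← hfac, h, zero_mul])
  have key : (Complex.I * X / ν) ^ 2 / (8 * phoBeta xω μ ν)
      = ((-(X ^ 2 * xω ^ 2 / (4 * (ν ^ 2 + μ ^ 2 * xω ^ 4))) : ℝ) : ℂ) +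
        ((-(X ^ 2 * xω ^ 4 * μ / (4 * ν * (ν ^ 2 + μ ^ 2 * xω ^ 4))) : ℝ) : ℂ) * Complex.I := by
    rw [show 8 * phoBeta xω μ ν = 4 * (2 * phoBeta xω μ ν) by ring, two_mul_phoBeta hxω hν]
    have hrhs : ((-(X ^ 2 * xω ^ 2 / (4 * (ν ^ 2 + μ ^ 2 * xω ^ 4))) : ℝ) : ℂ) +
        ((-(X ^ 2 * xω ^ 4 * μ / (4 * ν * (ν ^ 2 + μ ^ 2 * xω ^ 4))) : ℝ) : ℂ) * Complex.I
        = -(X ^ 2 * xω ^ 2 / (4 * ν * (ν ^ 2 + μ ^ 2 * xω ^ 4)))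
          * (ν + Complex.I * μ * xω ^ 2) := by
      push_cast
      field_simp
      ring
    have h4 : (ν : ℂ) + Complex.I * μ * xω ^ 2 ≠ 0 := fun h => hNc (by rw [← hfac, h, mul_zero])
    rw [hrhs, ← hfac, div_pow, mul_pow, Complex.I_sq]
    push_cast
    generalize (ν : ℂ) - Complex.I * μ * xω ^ 2 = A at *
    generalize (ν : ℂ) + Complex.I * μ * xω ^ 2 = B at *
    field_simp
  rw [key, Complex.norm_exp, ← Real.exp_nat_mul, Complex.add_re, Complex.ofReal_re,
    Complex.re_ofReal_mul, Complex.I_re]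
  congr 1
  push_cast
  field_simp
  ring

/-! ### The closed form for general `a` -/

theorem phoTerm_eq_zero (a : ℝ) {n k : ℕ} (hk : n < k) (xω μ ν X : ℝ) :
    phoTerm a n xω μ ν X k = 0 := by
  simp [phoTerm, ascPochhammer_eval_neg_coe_nat_of_lt hk]

theorem ascPochhammer_eval_ofReal (k : ℕ) (x : ℝ) :
    (((ascPochhammer ℝ k).eval x : ℝ) : ℂ) = (ascPochhammer ℂ k).eval (x : ℂ) := by
  induction k with
  | zero => simp
  | succ k ih => rw [ascPochhammer_succ_eval, ascPochhammer_succ_eval, ← ih]; push_cast; rfl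

theorem phoCoeff_mul_eq_phoTerm (a : ℝ) (n : ℕ) {xω ν : ℝ} (hxω : 0 < xω) (hν : ν ≠ 0)
    (μ X : ℝ) (k : ℕ) :
    (phoCoeff a n xω k : ℂ) *
        ((2 * phoBeta xω μ ν) ^ (-(((2 * k + phoB a + 3 / 2 : ℝ) : ℂ) / 2))
          * Complex.Gamma ((2 * k + phoB a + 3 / 2 : ℝ) : ℂ)
          * Complex.exp ((Complex.I * X / ν) ^ 2 / (8 * phoBeta xω μ ν))
          * parabolicCylinderD (-((2 * k + phoB a + 3 / 2 : ℝ) : ℂ))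
            (Complex.I * X / ν * (2 * phoBeta xω μ ν) ^ (-(1 / 2) : ℂ)))
      = ((Real.sqrt xω * Real.sqrt (2 * n.factorial / Real.Gamma (n + phoB a + 1)) *
          ((ascPochhammer ℝ n).eval (phoB a + 1) / n.factorial) : ℝ) : ℂ)
        * Complex.exp ((Complex.I * X / ν) ^ 2 / (8 * phoBeta xω μ ν))
        * phoTerm a n xω μ ν X k := by
  have hq := phoRatio_ne_zero hν xω μ
  rw [phoArg_eq hxω hν, two_mul_phoBeta hxω hν, ofReal_mul_cpow (by positivity) hq, phoTerm]
  have hx : (((1 / xω ^ 2 : ℝ) : ℂ)) ^ (-(((2 * k + phoB a + 3 / 2 : ℝ) : ℂ) / 2))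
      = ((xω ^ (2 * k + phoB a + 3 / 2) : ℝ) : ℂ) := by
    rw [show -(((2 * k + phoB a + 3 / 2 : ℝ) : ℂ) / 2)
      = ((-((2 * k + phoB a + 3 / 2) / 2) : ℝ) : ℂ) by push_cast; rfl,
      ← Complex.ofReal_cpow (by positivity), one_div, Real.inv_rpow (by positivity),
      Real.rpow_neg (by positivity), inv_inv, ← Real.rpow_natCast, ← Real.rpow_mul hxω.le]
    congr 2
    push_cast
    ring
  -- The powers of `xω` collapse to a factor independent of `k`, which can leave the sum.
  have hxx : 1 / Real.sqrt xω * xω ^ (-(2 * k + phoB a + 1 / 2)) * xω ^ (2 * k + phoB a + 3 / 2)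
      = Real.sqrt xω := by
    rw [mul_assoc, ← Real.rpow_add hxω, show -(2 * k + phoB a + 1 / 2) + (2 * k + phoB a + 3 / 2)
      = (1 : ℝ) by ring, Real.rpow_one, one_div_mul_eq_div, Real.div_sqrt]
  have hxx' := congrArg (fun t : ℝ => (t : ℂ)) hxx
  simp only [Complex.ofReal_mul] at hxx'
  rw [hx, phoCoeff,
    show -(((2 * k + phoB a + 3 / 2 : ℝ) : ℂ) / 2) = -((k : ℂ) + phoB a / 2 + 3 / 4) by
      push_cast; ring,
    show ((2 * k + phoB a + 3 / 2 : ℝ) : ℂ) = 2 * k + phoB a + 3 / 2 by push_cast; rfl]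
  simp only [Complex.ofReal_mul, Complex.ofReal_div, ascPochhammer_eval_ofReal,
    Complex.ofReal_add, Complex.ofReal_neg, Complex.ofReal_natCast, Complex.ofReal_one] at hxx' ⊢
  conv_rhs => rw [← hxx']
  ring

theorem summable_phoTerm (a : ℝ) (n : ℕ) (xω μ ν X : ℝ) : Summable (phoTerm a n xω μ ν X) :=
  summable_of_ne_finset_zero (s := Finset.range (n + 1)) fun k hk =>
    phoTerm_eq_zero a (by rw [Finset.mem_range] at hk; omega) xω μ ν X

theorem phoTomogram_eq (a : ℝ) (n : ℕ) {xω ν : ℝ} (hxω : 0 < xω) (hν : ν ≠ 0) (μ X : ℝ) :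
    phoTomogram a n xω μ ν X =
        xω / (2 * Real.pi * |ν|) * (2 * n.factorial / Real.Gamma (n + phoB a + 1))
          * Real.exp (-(X ^ 2 * xω ^ 2 / (2 * (ν ^ 2 + μ ^ 2 * xω ^ 4))))
          * ((ascPochhammer ℝ n).eval (phoB a + 1) / n.factorial) ^ 2
          * ‖∑' k : ℕ, phoTerm a n xω μ ν X k‖ ^ 2 := by
  have hG : 0 < Real.Gamma (n + phoB a + 1) :=
    Real.Gamma_pos_of_pos (by have := phoB_nonneg a; positivity)
  rw [phoTomogram, tomogram, integral_tomogramIntegrand a n hxω,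
    Finset.sum_congr rfl fun k _ => phoCoeff_mul_eq_phoTerm a n hxω hν μ X k, ← Finset.mul_sum,
    tsum_eq_sum (s := Finset.range (n + 1)) fun k hk =>
      phoTerm_eq_zero a (by rw [Finset.mem_range] at hk; omega) xω μ ν X,
    norm_mul, norm_mul, mul_pow, mul_pow, norm_cexp_phoBeta_sq hxω hν, Complex.norm_real,
    Real.norm_eq_abs, sq_abs, mul_pow, mul_pow, Real.sq_sqrt hxω.le, Real.sq_sqrt (by positivity)]
  ring

/-! ### Complex conjugation -/

theorem ascPochhammer_eval_conj (k : ℕ) (x : ℂ) :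
    (ascPochhammer ℂ k).eval ((starRingEnd ℂ) x)
      = (starRingEnd ℂ) ((ascPochhammer ℂ k).eval x) := by
  induction k with
  | zero => simp
  | succ k ih => rw [ascPochhammer_succ_eval, ascPochhammer_succ_eval, ih]; simp

theorem kummerM_conj (a c z : ℂ) :
    kummerM ((starRingEnd ℂ) a) ((starRingEnd ℂ) c) ((starRingEnd ℂ) z)
      = (starRingEnd ℂ) (kummerM a c z) := by
  rw [kummerM, kummerM, Complex.conj_tsum]
  refine tsum_congr fun k => ?_
  simp [ascPochhammer_eval_conj]

/-- Every ingredient has real Taylor coefficients or commutes with conjugation; the base `2` lies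
off the branch cut. -/
theorem parabolicCylinderD_conj (v z : ℂ) :
    parabolicCylinderD ((starRingEnd ℂ) v) ((starRingEnd ℂ) z)
      = (starRingEnd ℂ) (parabolicCylinderD v z) := by
  have h2 : (2 : ℂ) ^ ((starRingEnd ℂ) v / 2) = (starRingEnd ℂ) ((2 : ℂ) ^ (v / 2)) := by
    have := Complex.cpow_conj 2 (v / 2) (arg_ne_pi_of_re_pos (by norm_num))
    rwa [map_div₀, map_ofNat] at this
  have hk1 := kummerM_conj (-v / 2) (1 / 2) (z ^ 2 / 2)
  have hk2 := kummerM_conj ((1 - v) / 2) (3 / 2) (z ^ 2 / 2)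
  have hG1 := Complex.Gamma_conj ((1 - v) / 2)
  have hG2 := Complex.Gamma_conj (-v / 2)
  have he := Complex.exp_conj (-z ^ 2 / 4)
  simp only [map_div₀, map_neg, map_pow, map_ofNat, map_one, map_sub] at hk1 hk2 hG1 hG2 he
  simp only [parabolicCylinderD, map_mul, map_sub, map_div₀, Complex.conj_ofReal, hk1, hk2, hG1,
    hG2, he, h2]

theorem conj_phoArg {ν : ℝ} (hν : ν ≠ 0) (xω μ X : ℝ) :
    (starRingEnd ℂ) (phoArg xω μ ν X) = phoArg xω (-μ) ν (-X) := by
  have hre := re_abs_add_pos hν xω μ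
  have h := Complex.conj_cpow (((|ν| : ℝ) : ℂ) + Complex.I * ν.sign * μ * xω ^ 2) (1 / 2)
    (arg_ne_pi_of_re_pos hre)
  simp only [map_add, map_mul, map_pow, map_div₀, map_one, map_ofNat, Complex.conj_ofReal,
    Complex.conj_I] at h
  have hbase : ((|ν| : ℝ) : ℂ) + Complex.I * ν.sign * ((-μ : ℝ) : ℂ) * xω ^ 2
      = ((|ν| : ℝ) : ℂ) + -Complex.I * ν.sign * μ * xω ^ 2 := by push_cast; ring
  rw [phoArg, phoArg, hbase, h]
  simp only [map_mul, map_div₀, Complex.conj_ofReal, Complex.conj_I, neg_sq]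
  push_cast
  ring

/-! ### The state at `a = 0` and odd Hermite polynomials -/

theorem phoB_zero : phoB 0 = 1 / 2 := by simp [phoB]

/-- For `d = 0` truncated subtraction gives `0‼ = 1`, the value conventionally assigned to `(-1)‼`.
-/
theorem doubleFactorial_pred_two_mul (d : ℕ) :
    (2 * d - 1).doubleFactorial * (2 ^ d * d.factorial) = (2 * d).factorial := by
  cases d with
  | zero => simp
  | succ d =>
    rw [← Nat.doubleFactorial_two_mul, mul_comm, show 2 * (d + 1) - 1 = 2 * d + 1 by omega,
      show 2 * (d + 1) = 2 * d + 1 + 1 by ring, ← Nat.factorial_eq_mul_doubleFactorial]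

theorem Gamma_natCast_add_three_halves (k : ℕ) :
    Real.Gamma (k + 3 / 2) * k.factorial * 2 ^ (2 * k + 1)
      = Real.sqrt Real.pi * (2 * k + 1).factorial := by
  have h := Real.Gamma_nat_add_one_add_half k
  rw [show (k : ℝ) + 1 + 1 / 2 = k + 3 / 2 by ring] at h
  rw [h, Nat.factorial_eq_mul_doubleFactorial, Nat.doubleFactorial_two_mul]
  push_cast
  field_simp
  ring

theorem sum_range_two_mul {M : Type*} [AddCommMonoid M] (f : ℕ → M) (m : ℕ) :
    ∑ i ∈ Finset.range (2 * m), f i = ∑ i ∈ Finset.range m, (f (2 * i) + f (2 * i + 1)) := by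
  induction m with
  | zero => simp
  | succ m ih =>
    rw [show 2 * (m + 1) = 2 * m + 1 + 1 by ring, Finset.sum_range_succ, Finset.sum_range_succ,
      ih, Finset.sum_range_succ, add_assoc]

/-- Odd Hermite polynomials are Laguerre polynomials of parameter `1 / 2`. -/
theorem physHermite_two_mul_add_one (n : ℕ) (x : ℝ) :
    physHermite (2 * n + 1) x
      = (-1) ^ n * 2 ^ (2 * n + 1) * n.factorial * x * laguerreL n (1 / 2) (x ^ 2) := by
  rw [physHermite, Polynomial.aeval_eq_sum_range' (n := 2 * (n + 1))
    (by rw [Polynomial.natDegree_hermite]; omega), sum_range_two_mul, laguerreL, Finset.mul_sum,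
    Finset.mul_sum]
  refine Finset.sum_congr rfl fun i hi => ?_
  obtain ⟨d, rfl⟩ := Nat.exists_eq_add_of_le (Nat.lt_succ_iff.1 (Finset.mem_range.1 hi))
  -- Coefficients are compared degree by degree: even degrees vanish by parity, and degree `2 * i +
  -- 1` meets the `i`-th Laguerre term, with `d = n - i`.
  rw [Polynomial.coeff_hermite_of_odd_add ⟨i + d + i, by ring⟩,
    show 2 * (i + d) + 1 = 2 * d + (2 * i + 1) by ring, Polynomial.coeff_hermite_explicit,
    zero_smul, zero_add, Nat.add_sub_cancel_left]
  have hD : ((2 * d - 1).doubleFactorial : ℝ) * (2 ^ d * d.factorial) = (2 * d).factorial := by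
    exact_mod_cast doubleFactorial_pred_two_mul d
  have hC : ((2 * d + (2 * i + 1)).choose (2 * i + 1) : ℝ) * (2 * d).factorial *
      (2 * i + 1).factorial = (2 * d + (2 * i + 1)).factorial := by
    exact_mod_cast Nat.add_choose_mul_factorial_mul_factorial (2 * d) (2 * i + 1)
  have hGn := Gamma_natCast_add_three_halves (i + d)
  have hGi := Gamma_natCast_add_three_halves i
  rw [show 2 * (i + d) + 1 = 2 * d + (2 * i + 1) by ring] at hGn
  have hs : Real.sqrt 2 ^ (2 * d + (2 * i + 1)) * (Real.sqrt 2 * x) ^ (2 * i + 1)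
      = 2 ^ (2 * i + 1 + d) * x * (x ^ 2) ^ i := by
    have : Real.sqrt 2 ^ (2 * d + (2 * i + 1)) * Real.sqrt 2 ^ (2 * i + 1)
        = 2 ^ (2 * i + 1 + d) := by
      rw [← pow_add, show 2 * d + (2 * i + 1) + (2 * i + 1) = 2 * (2 * i + 1 + d) by ring, pow_mul,
        Real.sq_sqrt zero_le_two]
    rw [mul_pow, ← mul_assoc, this]
    ring
  have hGpos : Real.Gamma (i + 3 / 2) ≠ 0 := (Real.Gamma_pos_of_pos (by positivity)).ne'
  have hd : (d.factorial : ℝ) ≠ 0 := Nat.cast_ne_zero.2 (Nat.factorial_ne_zero _)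
  have hif : (i.factorial : ℝ) ≠ 0 := Nat.cast_ne_zero.2 (Nat.factorial_ne_zero _)
  -- The two half-integer Gamma values both carry `√π`, which is eliminated between them.
  have hmain : ((2 * d - 1).doubleFactorial : ℝ) * (2 * d + (2 * i + 1)).choose (2 * i + 1)
        * 2 ^ (2 * i + 1 + d)
      = 2 ^ (2 * d + (2 * i + 1)) * (i + d).factorial * Real.Gamma (i + d + 3 / 2)
        / (d.factorial * Real.Gamma (i + 3 / 2) * i.factorial) := by
    rw [eq_div_iff (by positivity)]
    push_cast at hGn
    rw [← hC, ← hD] at hGn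
    rw [pow_add 2 (2 * i + 1) d]
    linear_combination ((2 * d - 1).doubleFactorial : ℝ) * 2 ^ d * d.factorial *
      (2 * d + (2 * i + 1)).choose (2 * i + 1) * hGi - hGn
  have hsign : ((-1 : ℝ)) ^ (i + d) * (-1) ^ i = (-1) ^ d := by
    rw [pow_add, mul_right_comm, ← mul_pow]; norm_num
  rw [zsmul_eq_mul, mul_left_comm, hs, show ((i + d : ℕ) : ℝ) + 1 / 2 + 1 = i + d + 3 / 2 by
    push_cast; ring, show (1 : ℝ) / 2 + i + 1 = i + 3 / 2 by ring]
  push_cast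
  rw [← hsign]
  linear_combination ((-1 : ℝ) ^ (i + d) * (-1) ^ i * x * (x ^ 2) ^ i) * hmain

theorem phoWave_zero_eq_physHermite (n : ℕ) (xω : ℝ) {x : ℝ} (hx : 0 ≤ x) :
    phoWave 0 n xω x =
        (-1) ^ n / Real.sqrt xω * (1 / (2 : ℝ) ^ (2 * (n : ℝ) + 1 / 2))
          * Real.sqrt (1 / (n.factorial * Real.Gamma (n + 3 / 2)))
          * Real.exp (-(1 / 2) * (x ^ 2 / xω ^ 2)) * physHermite (2 * n + 1) (x / xω) := by
  rw [physHermite_two_mul_add_one]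
  rcases hx.eq_or_lt with rfl | hx
  -- At `x = 0` the wave function is `0` by definition, and the Hermite side has a factor `x`.
  · simp [phoWave]
  rw [phoWave, if_pos hx, phoB_zero, show (n : ℝ) + 1 / 2 + 1 = n + 3 / 2 by ring, div_pow]
  norm_num only [Real.rpow_one]
  have hG : 0 < Real.Gamma (n + 3 / 2) := Real.Gamma_pos_of_pos (by positivity)
  have hsqrt : Real.sqrt (2 * n.factorial / Real.Gamma (n + 3 / 2))
      = 1 / (2 : ℝ) ^ (2 * (n : ℝ) + 1 / 2)
        * Real.sqrt (1 / (n.factorial * Real.Gamma (n + 3 / 2)))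
        * (2 ^ (2 * n + 1) * n.factorial) := by
    have hf : (0 : ℝ) < n.factorial := Nat.cast_pos.2 (Nat.factorial_pos n)
    rw [Real.sqrt_eq_iff_mul_self_eq (by positivity) (by positivity), Real.rpow_add two_pos,
      ← Real.sqrt_eq_rpow, show 2 * (n : ℝ) = ((2 * n : ℕ) : ℝ) by push_cast; ring,
      Real.rpow_natCast]
    have h2 : Real.sqrt 2 ^ 2 = 2 := Real.sq_sqrt zero_le_two
    have h3 : Real.sqrt (1 / (n.factorial * Real.Gamma (n + 3 / 2))) ^ 2
        = 1 / (n.factorial * Real.Gamma (n + 3 / 2)) := Real.sq_sqrt (by positivity)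
    have h4 : (1 / (2 ^ (2 * n) * Real.sqrt 2) * Real.sqrt (1 / (n.factorial *
        Real.Gamma (n + 3 / 2))) * (2 ^ (2 * n + 1) * n.factorial)) *
        (1 / (2 ^ (2 * n) * Real.sqrt 2) * Real.sqrt (1 / (n.factorial *
        Real.Gamma (n + 3 / 2))) * (2 ^ (2 * n + 1) * n.factorial))
        = Real.sqrt (1 / (n.factorial * Real.Gamma (n + 3 / 2))) ^ 2 *
          (2 ^ (2 * n + 1) * n.factorial) ^ 2 / ((2 ^ (2 * n)) ^ 2 * Real.sqrt 2 ^ 2) := by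
      ring
    rw [h4, h2, h3]
    field_simp
    ring
  have hone : ((-1 : ℝ) ^ n) ^ 2 = 1 := by rw [← pow_mul, mul_comm, pow_mul]; norm_num
  rw [hsqrt]
  ring_nf
  simp only [mul_comm n 2, pow_mul]
  norm_num

/-! ### The double sum at `a = 0` -/

/-- Summand of the single sum for the amplitude of the tomogram at `a = 0`. -/
noncomputable def phoSummand (n : ℕ) (xω μ ν X : ℝ) (m : ℕ) : ℂ :=
  (-1) ^ m / m.factorial * (1 / (4 * (ν : ℂ))) ^ m * ((ν : ℂ) - Complex.I * μ * xω ^ 2) ^ m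
    * parabolicCylinderD (-(2 * n - 2 * m + 2)) (phoArg xω μ ν X)

theorem conj_phoSummand {ν : ℝ} (hν : ν ≠ 0) (n : ℕ) (xω μ X : ℝ) (m : ℕ) :
    (starRingEnd ℂ) (phoSummand n xω μ ν X m)
      = (-1) ^ m / m.factorial * (1 / (4 * (ν : ℂ))) ^ m * ((ν : ℂ) + Complex.I * μ * xω ^ 2) ^ m
        * parabolicCylinderD (-(2 * n - 2 * m + 2)) (phoArg xω (-μ) ν (-X)) := by
  have h := parabolicCylinderD_conj (-(2 * n - 2 * m + 2)) (phoArg xω μ ν X)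
  rw [conj_phoArg hν] at h
  simp only [map_neg, map_add, map_sub, map_mul, map_ofNat, map_natCast] at h
  simp only [phoSummand, map_mul, map_div₀, map_pow, map_neg, map_one, map_natCast, map_ofNat,
    map_sub, Complex.conj_ofReal, Complex.conj_I, h]
  ring

/-- With `k = n - m`, `Γ(2k + 2) = (2k + 1)!` cancels `(3/2)_k k!` up to `4 ^ k`. The exponent of
the ratio is the integer `-(k + 1)`, so a common power `-(n + 1)` splits off. -/
theorem phoTerm_zero_eq {n m : ℕ} (hm : m ≤ n) {ν : ℝ} (hν : ν ≠ 0) (xω μ X : ℝ) :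
    phoTerm 0 n xω μ ν X (n - m)
      = (-1) ^ n * 4 ^ n * n.factorial * ((((ν : ℂ) - Complex.I * μ * xω ^ 2) / ν) ^ (n + 1))⁻¹
        * phoSummand n xω μ ν X m := by
  obtain ⟨k, rfl⟩ := Nat.exists_eq_add_of_le hm
  have hq := phoRatio_ne_zero hν xω μ
  have hν2 : (ν : ℂ) ≠ 0 := Complex.ofReal_ne_zero.2 hν
  rw [Nat.add_sub_cancel_left, phoTerm, phoSummand, phoB_zero]
  have hneg : (ascPochhammer ℂ k).eval (-((m + k : ℕ) : ℂ))
      = (-1) ^ k * ((m + k).factorial / m.factorial) := by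
    have h := congrArg (fun t : ℝ => (t : ℂ))
      (ascPochhammer_eval_neg_natCast (Nat.le_add_left k m))
    rw [Nat.add_sub_cancel] at h
    simp only [ascPochhammer_eval_ofReal] at h
    push_cast at h ⊢
    exact h
  have hG : Complex.Gamma (2 * k + ((1 / 2 : ℝ) : ℂ) + 3 / 2) = (2 * k + 1).factorial := by
    rw [← Complex.Gamma_nat_eq_factorial]
    congr 1
    push_cast
    ring
  have hfac := factorial_two_mul_add_one_eq_ascPochhammer k
  have hP : (ascPochhammer ℂ k).eval (3 / 2) * (k.factorial : ℂ) ≠ 0 := by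
    intro h0
    rw [h0, mul_zero] at hfac
    exact Nat.factorial_ne_zero _ (Nat.cast_eq_zero.1 hfac)
  have hpow : (((ν : ℂ) - Complex.I * μ * xω ^ 2) / ν) ^
      (-((k : ℂ) + ((1 / 2 : ℝ) : ℂ) / 2 + 3 / 4))
        = ((((ν : ℂ) - Complex.I * μ * xω ^ 2) / ν) ^ (k + 1))⁻¹ := by
    rw [show (k : ℂ) + ((1 / 2 : ℝ) : ℂ) / 2 + 3 / 4 = ((k + 1 : ℕ) : ℂ) by push_cast; ring,
      Complex.cpow_neg, Complex.cpow_natCast]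
  have hD : -(2 * (k : ℂ) + ((1 / 2 : ℝ) : ℂ) + 3 / 2)
      = -(2 * ((m + k : ℕ) : ℂ) - 2 * m + 2) := by push_cast; ring
  have hhalf : ((1 / 2 : ℝ) : ℂ) + 1 = 3 / 2 := by push_cast; norm_num
  rw [hneg, hG, hpow, hD, hhalf, hfac]
  generalize (ascPochhammer ℂ k).eval (3 / 2) * (k.factorial : ℂ) = R at *
  rw [mul_comm ((4 : ℂ) ^ k), ← mul_assoc, div_mul_cancel₀ _ hP]
  have hqm : (1 / (4 * (ν : ℂ))) ^ m * ((ν : ℂ) - Complex.I * μ * xω ^ 2) ^ m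
      = (((ν : ℂ) - Complex.I * μ * xω ^ 2) / ν) ^ m / 4 ^ m := by
    rw [← mul_pow, ← div_pow]
    congr 1
    field_simp
  have hsign : ((-1 : ℂ)) ^ (m + k) * (-1) ^ m = (-1) ^ k := by
    rw [pow_add, mul_right_comm, ← mul_pow]; norm_num
  rw [mul_assoc ((-1 : ℂ) ^ m / m.factorial), hqm, ← hsign,
    show m + k + 1 = (k + 1) + m by ring, pow_add _ (k + 1) m, pow_add (4 : ℂ) m k]
  generalize ((ν : ℂ) - Complex.I * μ * xω ^ 2) / ν = q at *
  field_simp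

theorem norm_phoRatio_sq {ν : ℝ} (hν : ν ≠ 0) (xω μ : ℝ) :
    ‖((ν : ℂ) - Complex.I * μ * xω ^ 2) / ν‖ ^ 2 = (ν ^ 2 + μ ^ 2 * xω ^ 4) / |ν| ^ 2 := by
  rw [phoRatio_eq_conj hν, norm_mul, RCLike.norm_conj, mul_pow, norm_sq_abs_add hν,
    Complex.norm_real, Real.norm_of_nonneg (by positivity)]
  ring

theorem norm_tsum_phoTerm_zero_sq {ν : ℝ} (hν : ν ≠ 0) (n : ℕ) (xω μ X : ℝ) :
    ‖∑' k : ℕ, phoTerm 0 n xω μ ν X k‖ ^ 2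
      = (4 ^ n * n.factorial) ^ 2 * ((|ν| ^ 2) ^ (n + 1) / (ν ^ 2 + μ ^ 2 * xω ^ 4) ^ (n + 1))
        * ‖∑ m ∈ Finset.range (n + 1), phoSummand n xω μ ν X m‖ ^ 2 := by
  have hsum : ∑' k : ℕ, phoTerm 0 n xω μ ν X k
      = ∑ m ∈ Finset.range (n + 1), phoTerm 0 n xω μ ν X (n - m) := by
    rw [tsum_eq_sum (s := Finset.range (n + 1)) fun k hk =>
      phoTerm_eq_zero 0 (by rw [Finset.mem_range] at hk; omega) xω μ ν X,
      ← Finset.sum_range_reflect]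
    exact Finset.sum_congr rfl fun m _ => by simp
  rw [hsum, Finset.sum_congr rfl fun m hm => phoTerm_zero_eq
    (Nat.lt_succ_iff.1 (Finset.mem_range.1 hm)) hν xω μ X, ← Finset.mul_sum, norm_mul, mul_pow,
    norm_mul, mul_pow, norm_inv, norm_pow, inv_pow, ← pow_mul, mul_comm (n + 1) 2, pow_mul,
    norm_phoRatio_sq hν, div_pow, inv_div]
  simp

theorem ofReal_norm_sum_phoSummand_sq {ν : ℝ} (hν : ν ≠ 0) (n : ℕ) (xω μ X : ℝ) :
    ((‖∑ m ∈ Finset.range (n + 1), phoSummand n xω μ ν X m‖ ^ 2 : ℝ) : ℂ)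
      = ∑ m₁ ∈ Finset.range (n + 1), ∑ m₂ ∈ Finset.range (n + 1),
            (-1 : ℂ) ^ (m₁ + m₂) / (m₁.factorial * m₂.factorial)
              * (1 / (4 * (ν : ℂ))) ^ (m₁ + m₂)
              * ((ν : ℂ) - Complex.I * μ * xω ^ 2) ^ m₁
              * ((ν : ℂ) + Complex.I * μ * xω ^ 2) ^ m₂
              * parabolicCylinderD (-(2 * n - 2 * m₁ + 2)) (phoArg xω μ ν X)
              * parabolicCylinderD (-(2 * n - 2 * m₂ + 2)) (phoArg xω (-μ) ν (-X)) := by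
  rw [Complex.ofReal_pow, ← Complex.mul_conj', map_sum, Finset.sum_mul_sum]
  refine Finset.sum_congr rfl fun m₁ _ => Finset.sum_congr rfl fun m₂ _ => ?_
  rw [conj_phoSummand hν, phoSummand, pow_add, pow_add]
  ring

theorem phoTomogram_zero_eq (n : ℕ) {xω ν : ℝ} (hxω : 0 < xω) (hν : ν ≠ 0) (μ X : ℝ) :
    phoTomogram 0 n xω μ ν X
      = 1 / Real.pi * (((2 * n + 1).factorial : ℝ) ^ 2 / (n.factorial * Real.Gamma (n + 3 / 2)))
          * (|ν| ^ (2 * n + 1) * xω / (ν ^ 2 + μ ^ 2 * xω ^ 4) ^ (n + 1))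
          * Real.exp (-(X ^ 2 * xω ^ 2 / (2 * (ν ^ 2 + μ ^ 2 * xω ^ 4))))
        * ‖∑ m ∈ Finset.range (n + 1), phoSummand n xω μ ν X m‖ ^ 2 := by
  have hfac : ((2 * n + 1).factorial : ℝ)
      = 4 ^ n * ((ascPochhammer ℝ n).eval (3 / 2) * n.factorial) := by
    have h := factorial_two_mul_add_one_eq_ascPochhammer n
    have h2 := ascPochhammer_eval_ofReal n (3 / 2)
    push_cast at h2
    rw [← h2] at h
    exact_mod_cast h
  -- The constants combine through `4 ^ n * (3/2)_n = (2n + 1)! / n!`, and the prefactor `1 / |ν|`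
  -- lowers `|ν| ^ (2n + 2)` by one power.
  rw [phoTomogram_eq 0 n hxω hν, norm_tsum_phoTerm_zero_sq hν, phoB_zero,
    show (n : ℝ) + 1 / 2 + 1 = n + 3 / 2 by ring, show (1 : ℝ) / 2 + 1 = 3 / 2 by norm_num, hfac]
  have hG : 0 < Real.Gamma (n + 3 / 2) := Real.Gamma_pos_of_pos (by positivity)
  have hf : (n.factorial : ℝ) ≠ 0 := Nat.cast_ne_zero.2 (Nat.factorial_ne_zero n)
  have hν' : 0 < |ν| := abs_pos.2 hν
  have hN : 0 < ν ^ 2 + μ ^ 2 * xω ^ 4 := by positivity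
  generalize |ν| = r at *
  generalize ν ^ 2 + μ ^ 2 * xω ^ 4 = N at *
  generalize Real.exp _ = e
  generalize ‖∑ m ∈ Finset.range (n + 1), phoSummand n xω μ ν X m‖ = S
  field_simp
  ring

theorem mainTheorem5 (n : ℕ) (xω μ ν X : ℝ) (hxω : 0 < xω) (hν : ν ≠ 0) :
    -- the state at `a = 0` in terms of the Hermite polynomial `H_{2n+1}`
    (∀ x : ℝ, 0 ≤ x →
      phoWave 0 n xω x =
        (-1) ^ n / Real.sqrt xω * (1 / (2 : ℝ) ^ (2 * (n : ℝ) + 1 / 2))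
          * Real.sqrt (1 / (n.factorial * Real.Gamma (n + 3 / 2)))
          * Real.exp (-(1 / 2) * (x ^ 2 / xω ^ 2)) * physHermite (2 * n + 1) (x / xω)) ∧
    -- the integral that defines the tomogram converges absolutely
    (∀ a : ℝ, 0 ≤ a →
      MeasureTheory.Integrable
        (fun y : ℝ => tomogramIntegrand (fun t => (phoWave a n xω t : ℂ)) μ ν X y)) ∧
    -- closed form for `a = 0`
    ((phoTomogram 0 n xω μ ν X : ℝ) : ℂ) =
      ((1 / Real.pi * (((2 * n + 1).factorial : ℝ) ^ 2 / (n.factorial * Real.Gamma (n + 3 / 2)))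
          * (|ν| ^ (2 * n + 1) * xω / (ν ^ 2 + μ ^ 2 * xω ^ 4) ^ (n + 1))
          * Real.exp (-(X ^ 2 * xω ^ 2 / (2 * (ν ^ 2 + μ ^ 2 * xω ^ 4)))) : ℝ) : ℂ)
        * ∑ m₁ ∈ Finset.range (n + 1), ∑ m₂ ∈ Finset.range (n + 1),
            (-1 : ℂ) ^ (m₁ + m₂) / (m₁.factorial * m₂.factorial)
              * (1 / (4 * (ν : ℂ))) ^ (m₁ + m₂)
              * ((ν : ℂ) - Complex.I * μ * xω ^ 2) ^ m₁
              * ((ν : ℂ) + Complex.I * μ * xω ^ 2) ^ m₂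
              * parabolicCylinderD (-(2 * n - 2 * m₁ + 2)) (phoArg xω μ ν X)
              * parabolicCylinderD (-(2 * n - 2 * m₂ + 2)) (phoArg xω (-μ) ν (-X)) ∧
    -- closed form for general `a`
    (∀ a : ℝ, 0 ≤ a →
      Summable (phoTerm a n xω μ ν X) ∧
      phoTomogram a n xω μ ν X =
        xω / (2 * Real.pi * |ν|) * (2 * n.factorial / Real.Gamma (n + phoB a + 1))
          * Real.exp (-(X ^ 2 * xω ^ 2 / (2 * (ν ^ 2 + μ ^ 2 * xω ^ 4))))
          * ((ascPochhammer ℝ n).eval (phoB a + 1) / n.factorial) ^ 2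
          * ‖∑' k : ℕ, phoTerm a n xω μ ν X k‖ ^ 2) := by
  refine ⟨fun x hx => phoWave_zero_eq_physHermite n xω hx,
    fun a _ => integrable_tomogramIntegrand a n hxω μ ν X, ?_,
    fun a _ => ⟨summable_phoTerm a n xω μ ν X, phoTomogram_eq a n hxω hν μ X⟩⟩
  rw [phoTomogram_zero_eq n hxω hν, Complex.ofReal_mul, ofReal_norm_sum_phoSummand_sq hν]
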